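/- Let $p_1,p_2$ be nonnegative integers, let $X\in\mathbb R^{p_1}$ and $Z\in\mathbb R^{p_2}$ be independent random vectors, let $Z'$ be an independent copy of $Z$ (independent of $(X,Z)$), and let $\eta,\eta_c:\mathbb R^{p_1}\times\mathbb R^{p_2}\to\mathbb R$ be measurable (the fine and the coarse model). Put $Y=\eta(X,Z)$, $Y'=\eta(X,Z')$, $Y_c=\eta_c(X,Z)$, $Y_c'=\eta_c(X,Z')$, and assume that $Y$ and $Y_c$ have finite nonzero variance. Let $$S=\frac{\mathrm{Var}(\mathbb E(Y|X))}{\mathrm{Var}\,Y},\qquad S_c=\frac{\mathrm{Var}(\mathbb E(Y_c|X))}{\mathrm{Var}\,Y_c},$$ $$A=(Y-\mathbb EY)(Y'-\mathbb EY),\quad B=S\left[(Y-\mathbb EY)^2+(Y'-\mathbb EY)^2\right],$$ $$A_c=(Y_c-\mathbb EY_c)(Y_c'-\mathbb EY_c),\quad B_c=S_c\left[(Y_c-\mathbb EY_c)^2+(Y_c'-\mathbb EY_c)^2\right],$$ and assume that $A,B,A_c,B_c$ are square integrable. Let $\sigma_c,\sigma_e\ge 0$ be given by $$\sigma_c^2=\frac{\mathrm{Var}(A_c-B_c/2)}{(\mathrm{Var}\,Y_c)^2},$$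 $$\sigma_e^2=\sigma_c^2+\frac{\mathrm{Var}(A-B/2)}{(\mathrm{Var}\,Y)^2}-\frac{2\,\mathrm{Cov}(A,A_c)-\left(\mathrm{Cov}(A,B_c)+\mathrm{Cov}(B,A_c)\right)+\mathrm{Cov}(B,B_c)/2}{\mathrm{Var}\,Y\;\mathrm{Var}\,Y_c},$$ and assume $\sigma_e>0$. For a sequence of pairs $(u_i,v_i)_{i\ge 1}$ of real numbers let $$\mathcal T_n(u,v)=\frac{\frac1n\sum_{i=1}^n u_iv_i-\left(\frac1n\sum_{i=1}^n\frac{u_i+v_i}2\right)^2}{\frac1n\sum_{i=1}^n\frac{u_i^2+v_i^2}2-\left(\frac1n\sum_{i=1}^n\frac{u_i+v_i}2\right)^2}.$$ Let $(X_i,Z_i,Z_i')_{i\ge 1}$ and $(\tilde X_i,\tilde Z_i,\tilde Z_i')_{i\ge 1}$ be two sequences of random vectors on one probability space, each of them i.i.d. with the law of $(X,Z,Z')$; nothing is assumed on their joint law (they may be equal, or independent of each other). Let $\psi:\mathbb N\to\mathbb N$ and $$T_N=\mathcal T_N\left(\eta_c(X_i,Z_i),\eta_c(X_i,Z_i')\right),\qquad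 E_N=\mathcal T_{\psi(N)}\left(\eta(\tilde X_i,\tilde Z_i),\eta(\tilde X_i,\tilde Z_i')\right)-\mathcal T_{\psi(N)}\left(\eta_c(\tilde X_i,\tilde Z_i),\eta_c(\tilde X_i,\tilde Z_i')\right),$$ and $V_N=T_N+E_N$. Let $q(a)=\Phi^{-1}(1-a/2)$, where $\Phi$ is the standard Gaussian distribution function. If $\psi(N)\to+\infty$, then for all $\alpha_e,\alpha_c\in(0,1)$ $$\liminf_{N\to\infty}\;\mathbb P\left(|S-V_N|\le q(\alpha_e)\frac{\sigma_e}{\sqrt{\psi(N)}}+q(\alpha_c)\frac{\sigma_c}{\sqrt N}\right)\ge 1-(\alpha_e+\alpha_c).$$ The same holds when $\sigma_e$ and $\sigma_c$ are replaced by any real random variables $\hat\sigma_{e,N}$ and $\hat\sigma_{c,N}$ that converge in probability to $\sigma_e$ and $\sigma_c$ (with $\hat\sigma_{c,N}\ge 0$ almost surely in case $\sigma_c=0$). -/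

import Mathlib

open MeasureTheory ProbabilityTheory Filter Topology

noncomputable section

namespace PickFreeze

/-- The cumulative distribution function `Φ` of the standard Gaussian law. -/
def Phi (x : ℝ) : ℝ := cdf (gaussianReal 0 1) x

/-- The inverse `Φ⁻¹` of `Φ` (meaningful on the open interval from `0` to `1`). -/
def PhiInv : ℝ → ℝ := Function.invFun Phi

/-- `q(a) = Φ⁻¹(1 - a/2)`. -/
def q (a : ℝ) : ℝ := PhiInv (1 - a / 2)

/-- `PhiInv` is a right inverse of `Phi` on the open unit interval. -/
theorem Phi_PhiInv {p : ℝ} (h0 : 0 < p) (h1 : p < 1) : Phi (PhiInv p) = p := by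
  have hc : Continuous Phi := by
    have : ∀ x, ContinuousAt (cdf (gaussianReal 0 1)) x := by
      intro x
      have h := StieltjesFunction.measure_singleton (cdf (gaussianReal 0 1)) x
      have hna : gaussianReal 0 1 {x} = 0 := by
        have := nullSingletonClass_gaussianReal (μ := 0) (v := 1) one_ne_zero
        exact measure_singleton x
      rw [measure_cdf, hna, eq_comm, ENNReal.ofReal_eq_zero] at h
      rw [(monotone_cdf _).continuousAt_iff_leftLim_eq_rightLim, StieltjesFunction.rightLim_eq]
      exact le_antisymm ((monotone_cdf _).leftLim_le le_rfl) (by linarith)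
    exact continuous_iff_continuousAt.2 this
  have hex : ∃ x, Phi x = p := by
    obtain ⟨a, ha⟩ := ((tendsto_cdf_atBot (gaussianReal 0 1)).eventually (gt_mem_nhds h0)).exists
    obtain ⟨b, hb⟩ := ((tendsto_cdf_atTop (gaussianReal 0 1)).eventually (lt_mem_nhds h1)).exists
    exact mem_range_of_exists_le_of_exists_ge hc ⟨a, ha.le⟩ ⟨b, hb.le⟩
  exact Function.invFun_eq hex

section Population

variable {Ω : Type*} [MeasurableSpace Ω] {p₁ p₂ : ℕ}

/-- The output `ω ↦ f(X(ω), Z(ω))` of the model `f` at the random inputs `X`, `Z`. -/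
def output (f : (Fin p₁ → ℝ) × (Fin p₂ → ℝ) → ℝ) (X : Ω → Fin p₁ → ℝ) (Z : Ω → Fin p₂ → ℝ) :
    Ω → ℝ :=
  fun ω => f (X ω, Z ω)

/-- The (closed) Sobol index `Var(E(Y | X)) / Var(Y)` of `Y` with respect to `X`. -/
def sobolIndex (μ : Measure Ω) (X : Ω → Fin p₁ → ℝ) (Y : Ω → ℝ) : ℝ :=
  Var[μ[Y | MeasurableSpace.comap X inferInstance]; μ] / Var[Y; μ]

/-- The centred product `A = (Y - E Y)(Y' - E Y)`. -/
def centredProd (μ : Measure Ω) (Y Y' : Ω → ℝ) : Ω → ℝ :=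
  fun ω => (Y ω - μ[Y]) * (Y' ω - μ[Y])

/-- `B = S [(Y - E Y)² + (Y' - E Y)²]`, with `S` the Sobol index of `Y` with respect to `X`. -/
def centredSq (μ : Measure Ω) (X : Ω → Fin p₁ → ℝ) (Y Y' : Ω → ℝ) : Ω → ℝ :=
  fun ω => sobolIndex μ X Y * ((Y ω - μ[Y]) ^ 2 + (Y' ω - μ[Y]) ^ 2)

/-- `Var(A - B/2) / (Var Y)²`, the asymptotic variance of the pick-freeze estimator of the Sobol
index of `Y`. -/
def sigmaSq (μ : Measure Ω) (X : Ω → Fin p₁ → ℝ) (Y Y' : Ω → ℝ) : ℝ :=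
  Var[fun ω => centredProd μ Y Y' ω - centredSq μ X Y Y' ω / 2; μ] / Var[Y; μ] ^ 2

/-- The asymptotic standard deviation `σ_c` of the coarse estimator. -/
def sigmaC (μ : Measure Ω) (X : Ω → Fin p₁ → ℝ) (Yc Yc' : Ω → ℝ) : ℝ :=
  √(sigmaSq μ X Yc Yc')

/-- The asymptotic variance `σ_e²` of the correction term. -/
def sigmaESq (μ : Measure Ω) (X : Ω → Fin p₁ → ℝ) (Y Y' Yc Yc' : Ω → ℝ) : ℝ :=
  sigmaSq μ X Yc Yc' + sigmaSq μ X Y Y' -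
    (2 * cov[centredProd μ Y Y', centredProd μ Yc Yc'; μ]
      - (cov[centredProd μ Y Y', centredSq μ X Yc Yc'; μ]
        + cov[centredSq μ X Y Y', centredProd μ Yc Yc'; μ])
      + cov[centredSq μ X Y Y', centredSq μ X Yc Yc'; μ] / 2) / (Var[Y; μ] * Var[Yc; μ])

/-- The asymptotic standard deviation `σ_e` of the correction term. -/
def sigmaE (μ : Measure Ω) (X : Ω → Fin p₁ → ℝ) (Y Y' Yc Yc' : Ω → ℝ) : ℝ :=
  √(sigmaESq μ X Y Y' Yc Yc')

end Population

/-- The pick-freeze estimator computed from the first `n` terms of the paired sequences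
`(u i)` (sample of the output) and `(v i)` (sample of its pick-freeze replication). -/
def pickFreezeEstimator (n : ℕ) (u v : ℕ → ℝ) : ℝ :=
  ((1 / (n : ℝ)) * ∑ i ∈ Finset.range n, u i * v i
      - ((1 / (n : ℝ)) * ∑ i ∈ Finset.range n, (u i + v i) / 2) ^ 2) /
    ((1 / (n : ℝ)) * ∑ i ∈ Finset.range n, ((u i) ^ 2 + (v i) ^ 2) / 2
      - ((1 / (n : ℝ)) * ∑ i ∈ Finset.range n, (u i + v i) / 2) ^ 2)

section Sampling

variable {Ω Ω' : Type*} [MeasurableSpace Ω] [MeasurableSpace Ω'] {p₁ p₂ : ℕ}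

/-- A sequence of draws of the inputs: the triples `(X i, Z i, Z' i)` are independent and all
have the law of `(X, Z, Z')`. -/
structure IsInputSample (μ : Measure Ω) (X : Ω → Fin p₁ → ℝ) (Z Z' : Ω → Fin p₂ → ℝ)
    (P : Measure Ω') (Xs : ℕ → Ω' → Fin p₁ → ℝ) (Zs Zs' : ℕ → Ω' → Fin p₂ → ℝ) : Prop where
  indep : iIndepFun (fun i ω => (Xs i ω, Zs i ω, Zs' i ω)) P
  identDistrib : ∀ i, IdentDistrib (fun ω => (Xs i ω, Zs i ω, Zs' i ω))
    (fun ω => (X ω, Z ω, Z' ω)) P μ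

/-- The pick-freeze estimator of the model `f` computed from `n` draws of the inputs. -/
def modelEstimator (f : (Fin p₁ → ℝ) × (Fin p₂ → ℝ) → ℝ)
    (Xs : ℕ → Ω' → Fin p₁ → ℝ) (Zs Zs' : ℕ → Ω' → Fin p₂ → ℝ) (n : ℕ) (ω : Ω') : ℝ :=
  pickFreezeEstimator n (fun i => output f (Xs i) (Zs i) ω) (fun i => output f (Xs i) (Zs' i) ω)

/-- The correction term `E_N = T^η_{ψ(N)} - T_{ψ(N)}`: the fine model `f` and the coarse model
`fc` are evaluated at the same draws of the inputs. -/
def correction (f fc : (Fin p₁ → ℝ) × (Fin p₂ → ℝ) → ℝ) (ψ : ℕ → ℕ)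
    (Xs : ℕ → Ω' → Fin p₁ → ℝ) (Zs Zs' : ℕ → Ω' → Fin p₂ → ℝ) (N : ℕ) (ω : Ω') : ℝ :=
  modelEstimator f Xs Zs Zs' (ψ N) ω - modelEstimator fc Xs Zs Zs' (ψ N) ω

/-- The variance-reduced estimator `V_N = T_N + E_N`. The term `T_N` uses the draws
`(Xs, Zs, Zs')` and the correction `E_N` uses the draws `(Xr, Zr, Zr')`. -/
def varianceReduced (f fc : (Fin p₁ → ℝ) × (Fin p₂ → ℝ) → ℝ) (ψ : ℕ → ℕ)
    (Xs : ℕ → Ω' → Fin p₁ → ℝ) (Zs Zs' : ℕ → Ω' → Fin p₂ → ℝ)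
    (Xr : ℕ → Ω' → Fin p₁ → ℝ) (Zr Zr' : ℕ → Ω' → Fin p₂ → ℝ) (N : ℕ) (ω : Ω') : ℝ :=
  modelEstimator fc Xs Zs Zs' N ω + correction f fc ψ Xr Zr Zr' N ω

end Sampling

end PickFreeze

end

/-! The error splits as V_N - S = (T_N - S_c) + (E_N - (S - S_c)). If the bound fails, one of the
two summands exceeds its own share of it. A union bound therefore suffices, and no joint law of the
two samples is needed. It remains to show that each summand exceeds its share with asymptotic
probability at most α_c, respectively α_e.

Both follow from asymptotic linearity (`tendstoInMeasure_modelEstimator_sub_score`). Let W = A -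
B/2, let M be the empirical mean of the half-sums of the centred outputs, and let D be the
denominator of the estimator. Where D ≠ 0, the estimator minus S is exactly (mean of W - (1 - S) M²)
/ D. Here W has mean zero because E A = Var E(Y|X) = S Var Y, while D → Var Y almost surely and √n
M² → 0 in probability. Hence √n times the error behaves like √n times the mean of the i.i.d.
variables W / Var Y. The difference of the fine and coarse estimators is driven in the same way by W
/ Var Y - W_c / Var Y_c, whose variance is σ_e². The central limit theorem, Slutsky's lemma and the
portmanteau theorem then give the asymptotic levels, also with consistent estimators of the standard
deviations.

The case σ_c = 0 has no Gaussian limit to use. There W_c = 0 almost surely, which forces S_c = 1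
(`sobolIndex_eq_one_of_ae_eq`). The coarse estimator then equals 1 exactly as soon as its
denominator is nonzero. -/

noncomputable section

namespace PickFreeze

/-! ### Gaussian quantiles and tails -/

section Gaussian

theorem PhiInv_lt_PhiInv {a b : ℝ} (ha : 0 < a) (hab : a < b) (hb : b < 1) :
    PhiInv a < PhiInv b := by
  by_contra! h
  have hmono : Phi (PhiInv b) ≤ Phi (PhiInv a) := monotone_cdf _ h
  rw [Phi_PhiInv ha (hab.trans hb), Phi_PhiInv (ha.trans hab) hb] at hmono
  linarith

theorem gaussianReal_real_Ici (c : ℝ) : (gaussianReal 0 1).real (Set.Ici c) = 1 - Phi c := by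
  have := nullSingletonClass_gaussianReal (μ := 0) (v := 1) one_ne_zero
  rw [Phi, cdf_eq_real, measureReal_congr Ioi_ae_eq_Ici.symm, ← Set.compl_Iic,
    probReal_compl_eq_one_sub measurableSet_Iic]

theorem gaussianReal_real_Iic_neg (c : ℝ) :
    (gaussianReal 0 1).real (Set.Iic (-c)) = 1 - Phi c := by
  rw [← gaussianReal_real_Ici]
  have h := gaussianReal_map_neg (μ := 0) (v := 1)
  rw [neg_zero] at h
  conv_lhs => rw [← h]
  rw [map_measureReal_apply (by fun_prop) measurableSet_Iic]
  congr 1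
  ext x
  simp

theorem Phi_zero : Phi 0 = 1 / 2 := by
  have h := gaussianReal_real_Iic_neg 0
  rw [neg_zero, ← cdf_eq_real, ← Phi] at h
  linarith

theorem q_pos {a : ℝ} (ha : a ∈ Set.Ioo (0 : ℝ) 1) : 0 < q a := by
  by_contra! h
  have hmono : Phi (q a) ≤ Phi 0 := monotone_cdf _ h
  rw [q, Phi_PhiInv (by linarith [ha.2]) (by linarith [ha.1]), Phi_zero] at hmono
  linarith [ha.2]

theorem q_lt_q {a b : ℝ} (ha : 0 < a) (hab : a < b) (hb : b < 1) : q b < q a :=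
  PhiInv_lt_PhiInv (by linarith) (by linarith) (by linarith)

theorem gaussianReal_real_q_le_abs {a : ℝ} (ha : a ∈ Set.Ioo (0 : ℝ) 1) :
    (gaussianReal 0 1).real {x | q a ≤ |x|} ≤ a := by
  have hsub : {x : ℝ | q a ≤ |x|} ⊆ Set.Ici (q a) ∪ Set.Iic (-q a) := by
    intro x hx
    rcases le_abs.1 (show q a ≤ |x| from hx) with h | h
    · exact Or.inl h
    · exact Or.inr (show x ≤ -q a by linarith)
  refine (measureReal_mono hsub).trans ((measureReal_union_le _ _).trans ?_)
  rw [gaussianReal_real_Ici, gaussianReal_real_Iic_neg, q,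
    Phi_PhiInv (by linarith [ha.2]) (by linarith [ha.1])]
  linarith

end Gaussian

/-! ### Slutsky-type lemmas and asymptotic levels -/

section Convergence

variable {Ω : Type*} [MeasurableSpace Ω] {P : Measure Ω} [IsProbabilityMeasure P]

/-- One half of the portmanteau theorem, for convergence in distribution of random variables. -/
theorem eventually_measureReal_mem_lt {Ω' : Type*} [MeasurableSpace Ω'] {P' : Measure Ω'}
    [IsProbabilityMeasure P'] {G : ℕ → Ω → ℝ} {H : Ω' → ℝ}
    (h : TendstoInDistribution G atTop H (fun _ => P) P') {F : Set ℝ} (hF : IsClosed F) {c : ℝ}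
    (hc : P'.real (H ⁻¹' F) < c) : ∀ᶠ n in atTop, P.real (G n ⁻¹' F) < c := by
  have hlim := ProbabilityMeasure.limsup_measure_closed_le_of_tendsto h.tendsto hF
  simp only [ProbabilityMeasure.coe_mk] at hlim
  have hc0 : 0 < c := measureReal_nonneg.trans_lt hc
  have hlt : (Measure.map H P') F < ENNReal.ofReal c := by
    rw [Measure.map_apply_of_aemeasurable h.aemeasurable_limit hF.measurableSet]
    rwa [← ofReal_measureReal, ENNReal.ofReal_lt_ofReal_iff hc0]
  filter_upwards [eventually_lt_of_limsup_lt (hlim.trans_lt hlt)] with n hn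
  rw [Measure.map_apply_of_aemeasurable (h.forall_aemeasurable n) hF.measurableSet,
    ← ofReal_measureReal, ENNReal.ofReal_lt_ofReal_iff hc0] at hn
  exact hn

/-- Slutsky: the pair converges jointly to (H, 0), so the product tends in law to the constant 0.
The portmanteau bound on {ε ≤ ‖x‖}, which misses 0, turns this into convergence in measure. -/
theorem tendstoInMeasure_mul_of_tendstoInDistribution {Ω' : Type*} [MeasurableSpace Ω']
    {P' : Measure Ω'} [IsProbabilityMeasure P'] {G R : ℕ → Ω → ℝ} {H : Ω' → ℝ}
    (hG : TendstoInDistribution G atTop H (fun _ => P) P')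
    (hR : ∀ᵐ ω ∂P, Tendsto (fun n => R n ω) atTop (𝓝 0)) (hRm : ∀ n, AEMeasurable (R n) P) :
    TendstoInMeasure P (fun n ω => G n ω * R n ω) atTop (fun _ => 0) := by
  have hRP : TendstoInMeasure P R atTop (fun _ => (0 : ℝ)) :=
    tendstoInMeasure_of_tendsto_ae (fun n => (hRm n).aestronglyMeasurable) hR
  have hprod := hG.continuous_comp_prodMk_of_tendstoInMeasure_const
    (g := fun x : ℝ × ℝ => x.1 * x.2) (by fun_prop) hRP hRm
  simp only [mul_zero] at hprod
  rw [tendstoInMeasure_iff_measureReal_norm]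
  intro ε hε
  refine tendsto_order.2 ⟨fun a ha => .of_forall fun n => ha.trans_le measureReal_nonneg,
    fun a ha => ?_⟩
  have hF : IsClosed {x : ℝ | ε ≤ ‖x‖} := isClosed_le continuous_const continuous_norm
  filter_upwards [eventually_measureReal_mem_lt hprod hF (c := a) (by simpa [hε.not_ge] using ha)]
    with n hn
  simpa using hn

theorem tendstoInMeasure_add {f g : ℕ → Ω → ℝ}
    (hf : TendstoInMeasure P f atTop (fun _ => 0)) (hg : TendstoInMeasure P g atTop (fun _ => 0)) :
    TendstoInMeasure P (fun n ω => f n ω + g n ω) atTop (fun _ => 0) := by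
  rw [tendstoInMeasure_iff_measureReal_norm] at *
  intro ε hε
  have h := (hf (ε / 2) (by positivity)).add (hg (ε / 2) (by positivity))
  rw [add_zero] at h
  refine squeeze_zero (fun _ => measureReal_nonneg) (fun n => ?_) h
  refine (measureReal_mono ?_).trans (measureReal_union_le _ _)
  intro ω hω
  by_contra! hcon
  simp only [Set.mem_union, Set.mem_ofPred_eq, not_or, not_le, sub_zero] at hcon hω
  linarith [norm_add_le (f n ω) (g n ω)]

theorem tendstoInMeasure_const_mul (c : ℝ) {f : ℕ → Ω → ℝ}
    (hf : TendstoInMeasure P f atTop (fun _ => 0)) :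
    TendstoInMeasure P (fun n ω => c * f n ω) atTop (fun _ => 0) := by
  rcases eq_or_ne c 0 with rfl | hc
  · simp only [zero_mul]
    exact tendstoInMeasure_of_tendsto_ae (fun _ => by fun_prop) (ae_of_all _ fun _ => by simp)
  rw [tendstoInMeasure_iff_measureReal_norm] at *
  intro ε hε
  have hc' : 0 < |c| := abs_pos.2 hc
  convert hf (ε / |c|) (by positivity) using 4 with n
  ext ω
  simp [div_le_iff₀' hc']

/-- Asymptotic level of the confidence bound `q(a) σ̂` for an asymptotically normal sequence and a
consistent, possibly non-measurable, estimator `σ̂` of its standard deviation. -/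
theorem eventually_measureReal_q_mul_lt_abs {G σ' : ℕ → Ω → ℝ} {σ a ε : ℝ} (hσ : 0 < σ)
    (hG : TendstoInDistribution G atTop (fun x => σ * x) (fun _ => P) (gaussianReal 0 1))
    (hσ' : TendstoInMeasure P σ' atTop (fun _ => σ)) (ha : a ∈ Set.Ioo (0 : ℝ) 1) (hε : 0 < ε) :
    ∀ᶠ n in atTop, P.real {ω | q a * σ' n ω < |G n ω|} < a + ε := by
  -- A level b slightly above a gives a strictly smaller quantile; the gap q a - q b absorbs the
  -- error of σ'.
  obtain ⟨b, hab, hb⟩ := exists_between (lt_min (show a < a + ε / 2 by linarith) ha.2)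
  rw [lt_min_iff] at hb
  have hb01 : b ∈ Set.Ioo (0 : ℝ) 1 := ⟨ha.1.trans hab, hb.2⟩
  have hqa := q_pos ha
  have hqab := q_lt_q ha.1 hab hb.2
  -- Solution of q a (σ - δ) = q b σ.
  set δ := σ * (q a - q b) / q a with hδ
  have hδ0 : 0 < δ := by have := sub_pos.2 hqab; positivity
  have hF : IsClosed {x : ℝ | q b * σ ≤ |x|} := isClosed_le continuous_const continuous_abs
  have h1 := eventually_measureReal_mem_lt hG hF (c := a + ε / 2) (by
    have : (fun x : ℝ => σ * x) ⁻¹' {x : ℝ | q b * σ ≤ |x|} = {x | q b ≤ |x|} := by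
      ext x
      simp [abs_mul, abs_of_pos hσ, mul_comm σ, hσ]
    rw [this]
    exact (gaussianReal_real_q_le_abs hb01).trans_lt hb.1)
  rw [tendstoInMeasure_iff_measureReal_norm] at hσ'
  have h2 := (hσ' δ hδ0).eventually (gt_mem_nhds (half_pos hε))
  filter_upwards [h1, h2] with n hn1 hn2
  have hsub : {ω | q a * σ' n ω < |G n ω|} ⊆
      G n ⁻¹' {x | q b * σ ≤ |x|} ∪ {ω | δ ≤ ‖σ' n ω - σ‖} := by
    intro ω hω
    by_contra! hcon
    simp only [Set.mem_union, Set.mem_preimage, Set.mem_ofPred_eq, not_or, not_le,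
      Real.norm_eq_abs] at hcon hω
    have hge : σ - δ < σ' n ω := by linarith [(abs_lt.1 hcon.2).1]
    have hmul : q a * (σ - δ) = q b * σ := by rw [hδ]; field_simp; ring
    nlinarith [mul_lt_mul_of_pos_left hge hqa]
  calc P.real _ ≤ _ := measureReal_mono hsub
    _ ≤ _ := measureReal_union_le _ _
    _ < (a + ε / 2) + ε / 2 := add_lt_add hn1 hn2
    _ = a + ε := by ring

end Convergence

/-! ### Limit theorems for empirical means -/

section SampleMean

variable {Ω Ω' E : Type*}

/-- The empirical mean of `g` over the first `n` terms of the sample `ξ`. -/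
def sampleMean (ξ : ℕ → Ω' → E) (g : E → ℝ) (n : ℕ) (ω : Ω') : ℝ :=
  1 / (n : ℝ) * ∑ i ∈ Finset.range n, g (ξ i ω)

variable [MeasurableSpace Ω] [MeasurableSpace Ω'] [MeasurableSpace E] {μ : Measure Ω}
  {P : Measure Ω'} {τ : Ω → E}
  {ξ : ℕ → Ω' → E} {g : E → ℝ}

theorem aemeasurable_sampleMean (hd : ∀ i, IdentDistrib (ξ i) τ P μ) (hg : Measurable g) (n : ℕ) :
    AEMeasurable (sampleMean ξ g n) P :=
  (Finset.aemeasurable_fun_sum _ fun i _ => hg.comp_aemeasurable (hd i).aemeasurable_fst).const_mul _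

theorem ae_tendsto_sampleMean (hξ : iIndepFun ξ P) (hd : ∀ i, IdentDistrib (ξ i) τ P μ)
    (hg : Measurable g) (hint : Integrable (fun ω => g (τ ω)) μ) :
    ∀ᵐ ω ∂P, Tendsto (fun n => sampleMean ξ g n ω) atTop (𝓝 (∫ ω, g (τ ω) ∂μ)) := by
  have hd' : ∀ i, IdentDistrib (fun ω => g (ξ i ω)) (fun ω => g (τ ω)) P μ :=
    fun i => (hd i).comp hg
  have h := strong_law_ae (fun i ω => g (ξ i ω)) ((hd' 0).integrable_iff.2 hint)
    (fun i j hij => (hξ.indepFun hij).comp hg hg) (fun i => (hd' i).trans (hd' 0).symm)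
  rw [(hd' 0).integral_eq] at h
  simpa [sampleMean] using h

/-- Writing the limit as a multiple of a standard Gaussian variable covers variance zero as well. -/
theorem tendstoInDistribution_sqrt_mul_sampleMean [IsProbabilityMeasure P] (hξ : iIndepFun ξ P)
    (hd : ∀ i, IdentDistrib (ξ i) τ P μ) (hg : Measurable g)
    (hL2 : MemLp (fun ω => g (τ ω)) 2 μ) (h0 : ∫ ω, g (τ ω) ∂μ = 0) :
    TendstoInDistribution (fun (n : ℕ) ω => √n * sampleMean ξ g n ω) atTop
      (fun x => √Var[fun ω => g (τ ω); μ] * x) (fun _ => P) (gaussianReal 0 1) := by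
  have hd' : ∀ i, IdentDistrib (fun ω => g (ξ i ω)) (fun ω => g (τ ω)) P μ :=
    fun i => (hd i).comp hg
  have hlaw : HasLaw (fun x : ℝ => √Var[fun ω => g (τ ω); μ] * x)
      (gaussianReal 0 Var[fun ω => g (ξ 0 ω); P].toNNReal) (gaussianReal 0 1) := by
    have h := gaussianReal_const_mul (HasLaw.id (μ := gaussianReal 0 1))
      (√Var[fun ω => g (τ ω); μ])
    convert h using 2
    · rfl
    · rw [mul_zero]
    · refine NNReal.eq ?_
      simp [(hd' 0).variance_eq, Real.sq_sqrt (variance_nonneg _ _), variance_nonneg]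
  have h := tendstoInDistribution_inv_sqrt_mul_sum_sub (X := fun i ω => g (ξ i ω)) hlaw
    ((hd' 0).memLp_iff.2 hL2) (hξ.comp (fun _ => g) fun _ => hg)
    (fun i => (hd' i).trans (hd' 0).symm)
  rw [(hd' 0).integral_eq, h0] at h
  convert h using 3 with n ω
  rw [sampleMean, mul_zero, sub_zero, ← mul_assoc]
  congr 1
  -- √n / n = 1 / √n also holds at n = 0, where both sides are 0.
  rw [mul_one_div, Real.sqrt_div_self', one_div]

end SampleMean

/-! ### Moments of the pick-freeze pair and its degenerate case -/

section PopulationFacts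

theorem variance_fun_div_const {Ω : Type*} [MeasurableSpace Ω] {μ : Measure Ω} (W : Ω → ℝ) (c : ℝ) :
    Var[fun ω => W ω / c; μ] = Var[W; μ] / c ^ 2 := by
  simp_rw [div_eq_inv_mul, variance_const_mul, inv_pow]

variable {Ω : Type*} [MeasurableSpace Ω] {p₁ p₂ : ℕ} {μ : Measure Ω} [IsProbabilityMeasure μ]
  {X : Ω → Fin p₁ → ℝ} {Z Z' : Ω → Fin p₂ → ℝ} {f : (Fin p₁ → ℝ) × (Fin p₂ → ℝ) → ℝ}

theorem map_inputs (hX : Measurable X) (hZ : Measurable Z) (hZ' : Measurable Z')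
    (hXZ : IndepFun X Z μ) (hXZZ' : IndepFun (fun ω => (X ω, Z ω)) Z' μ)
    (hcopy : IdentDistrib Z' Z μ μ) :
    μ.map (fun ω => (X ω, Z ω, Z' ω)) = (μ.map X).prod ((μ.map Z).prod (μ.map Z)) := by
  have := Measure.isProbabilityMeasure_map (μ := μ) hX.aemeasurable
  have := Measure.isProbabilityMeasure_map (μ := μ) hZ.aemeasurable
  have h1 := hXZ.map_prod_eq_prod_map_map hX.aemeasurable hZ.aemeasurable
  have h2 := hXZZ'.map_prod_eq_prod_map_map (hX.prodMk hZ).aemeasurable hZ'.aemeasurable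
  rw [h1, hcopy.map_eq] at h2
  rw [← Measure.prodAssoc_prod, ← h2, Measure.map_map (MeasurableEquiv.measurable _) (by fun_prop)]
  rfl

theorem identDistrib_output (hX : Measurable X) (hZ : Measurable Z) (hZ' : Measurable Z')
    (hXZ : IndepFun X Z μ) (hXZZ' : IndepFun (fun ω => (X ω, Z ω)) Z' μ)
    (hcopy : IdentDistrib Z' Z μ μ) (hf : Measurable f) :
    IdentDistrib (output f X Z') (output f X Z) μ μ := by
  have h1 := hXZ.map_prod_eq_prod_map_map hX.aemeasurable hZ.aemeasurable
  have h2 := (hXZZ'.comp measurable_fst measurable_id).map_prod_eq_prod_map_map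
    hX.aemeasurable hZ'.aemeasurable
  have hpair : IdentDistrib (fun ω => (X ω, Z' ω)) (fun ω => (X ω, Z ω)) μ μ :=
    ⟨by fun_prop, by fun_prop, by rw [h1, ← hcopy.map_eq]; exact h2⟩
  exact hpair.comp hf

/-- By independence, the conditional law of Z given X is the constant kernel with value the law of
Z. -/
theorem condExp_output_ae_eq (hX : Measurable X) (hZ : Measurable Z) (hXZ : IndepFun X Z μ)
    (hf : Measurable f) (hint : Integrable (output f X Z) μ) :
    μ[output f X Z | MeasurableSpace.comap X inferInstance] =ᵐ[μ]
      fun ω => ∫ z, f (X ω, z) ∂(μ.map Z) := by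
  have hp := Measure.isProbabilityMeasure_map (μ := μ) hZ.aemeasurable
  have h1 := hXZ.map_prod_eq_prod_map_map hX.aemeasurable hZ.aemeasurable
  rw [← Measure.compProd_const] at h1
  have h2 := ae_of_ae_map hX.aemeasurable
    (condDistrib_ae_eq_of_measure_eq_compProd X hZ.aemeasurable h1)
  have h3 := condExp_prod_ae_eq_integral_condDistrib hX hZ.aemeasurable hf.stronglyMeasurable hint
  filter_upwards [h2, h3] with ω hω2 hω3
  exact hω3.trans (by rw [hω2, Kernel.const_apply])

/-- Given X = x, the two outputs are independent with common mean g(x), so the inner Fubini integral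
factors into (g(x) - m)². -/
theorem integral_centredProd (hX : Measurable X) (hZ : Measurable Z) (hZ' : Measurable Z')
    (hXZ : IndepFun X Z μ) (hXZZ' : IndepFun (fun ω => (X ω, Z ω)) Z' μ)
    (hcopy : IdentDistrib Z' Z μ μ) (hf : Measurable f) (hint : Integrable (output f X Z) μ)
    (hA : Integrable (centredProd μ (output f X Z) (output f X Z')) μ) :
    ∫ ω, centredProd μ (output f X Z) (output f X Z') ω ∂μ =
      Var[μ[output f X Z | MeasurableSpace.comap X inferInstance]; μ] := by
  have := Measure.isProbabilityMeasure_map (μ := μ) hX.aemeasurable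
  have := Measure.isProbabilityMeasure_map (μ := μ) hZ.aemeasurable
  set m := μ[output f X Z] with hm
  set g : (Fin p₁ → ℝ) → ℝ := fun x => ∫ z, f (x, z) ∂(μ.map Z) with hg
  have hgm : Measurable g := hf.stronglyMeasurable.integral_prod_right'.measurable
  have hcond : μ[output f X Z | MeasurableSpace.comap X inferInstance] =ᵐ[μ] fun ω => g (X ω) :=
    condExp_output_ae_eq hX hZ hXZ hf hint
  have hmean : ∫ ω, g (X ω) ∂μ = m := by
    rw [← integral_congr_ae hcond, integral_condExp hX.comap_le]
  rw [variance_congr hcond, variance_eq_integral (by fun_prop), hmean,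
    ← integral_map (f := fun x => (g x - m) ^ 2) hX.aemeasurable (by fun_prop)]
  let k : (Fin p₁ → ℝ) × (Fin p₂ → ℝ) × (Fin p₂ → ℝ) → ℝ :=
    fun t => (f (t.1, t.2.1) - m) * (f (t.1, t.2.2) - m)
  have hk : Measurable k := by fun_prop
  have hT : AEMeasurable (fun ω => (X ω, Z ω, Z' ω)) μ := by fun_prop
  have hlaw := map_inputs hX hZ hZ' hXZ hXZZ' hcopy
  have hkint : Integrable k ((μ.map X).prod ((μ.map Z).prod (μ.map Z))) := by
    rw [← hlaw, integrable_map_measure hk.aestronglyMeasurable hT]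
    exact hA
  have hfint : Integrable f ((μ.map X).prod (μ.map Z)) := by
    rw [← hXZ.map_prod_eq_prod_map_map hX.aemeasurable hZ.aemeasurable,
      integrable_map_measure hf.aestronglyMeasurable (hX.prodMk hZ).aemeasurable]
    exact hint
  calc ∫ ω, centredProd μ (output f X Z) (output f X Z') ω ∂μ
      = ∫ t, k t ∂(μ.map fun ω => (X ω, Z ω, Z' ω)) :=
        (integral_map hT hk.aestronglyMeasurable).symm
    _ = ∫ x, ∫ z, k (x, z) ∂((μ.map Z).prod (μ.map Z)) ∂(μ.map X) := by
        rw [hlaw, integral_prod _ hkint]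
    _ = ∫ x, (g x - m) ^ 2 ∂(μ.map X) := by
        refine integral_congr_ae ?_
        filter_upwards [hfint.prod_right_ae] with x hx
        have hx1 : ∫ z, (f (x, z) - m) ∂(μ.map Z) = g x - m := by
          rw [integral_sub hx (integrable_const _)]
          simp [hg]
        have := integral_prod_mul (μ := μ.map Z) (ν := μ.map Z) (fun z => f (x, z) - m)
          (fun z => f (x, z) - m)
        rw [hx1, ← pow_two] at this
        exact this

/-- If a measure `ρ` charges no pair of values of `h` off the zero set of a continuous kernel `k`
that vanishes on the diagonal only at `(m, m)`, then `h = m` almost everywhere. -/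
theorem ae_eq_const_of_ae_prod_eq_zero {E : Type*} [MeasurableSpace E] {ρ : Measure E} [SFinite ρ]
    {h : E → ℝ} (hh : Measurable h) {k : ℝ × ℝ → ℝ} (hk : Continuous k) {m : ℝ}
    (hdiag : ∀ a, a ≠ m → k (a, a) ≠ 0)
    (h0 : ∀ᵐ z ∂(ρ.prod ρ), k (h z.1, h z.2) = 0) : ∀ᵐ z ∂ρ, h z = m := by
  have hnull : (ρ.map h) {a | a ≠ m} = 0 := by
    -- By continuity, a ≠ m has a neighbourhood U with k ≠ 0 on U × U. The hypothesis then gives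
    -- ρ(h⁻¹ U)² = 0.
    refine measure_null_of_locally_null _ fun a ha => ?_
    have hopen : {p : ℝ × ℝ | k p ≠ 0} ∈ 𝓝 (a, a) :=
      (isOpen_ne_fun hk continuous_const).mem_nhds (hdiag a ha)
    rw [nhds_prod_eq, (nhds_basis_opens a).prod_self.mem_iff] at hopen
    obtain ⟨U, ⟨hU, hUo⟩, hUk⟩ := hopen
    refine ⟨U, mem_nhdsWithin_of_mem_nhds (hUo.mem_nhds hU), ?_⟩
    rw [Measure.map_apply hh hUo.measurableSet]
    have hsub : (h ⁻¹' U) ×ˢ (h ⁻¹' U) ⊆ {z : E × E | ¬ k (h z.1, h z.2) = 0} :=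
      fun z hz => hUk (show (h z.1, h z.2) ∈ U ×ˢ U from ⟨hz.1, hz.2⟩)
    have hz := measure_mono_null hsub (ae_iff.1 h0)
    rw [Measure.prod_prod] at hz
    exact mul_self_eq_zero.1 hz
  rw [Measure.map_apply hh (isOpen_ne.measurableSet)] at hnull
  exact hnull

/-- On the diagonal the kernel of A - B/2 is (1 - s)(a - m)². If s ≠ 1, then for almost every x the
section f(x, ·) is almost surely m, so the output is constant and its variance vanishes. -/
theorem sobolIndex_eq_one_of_ae_eq (hX : Measurable X) (hZ : Measurable Z) (hZ' : Measurable Z')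
    (hXZ : IndepFun X Z μ) (hXZZ' : IndepFun (fun ω => (X ω, Z ω)) Z' μ)
    (hcopy : IdentDistrib Z' Z μ μ) (hf : Measurable f) (hvar : Var[output f X Z; μ] ≠ 0)
    (h0 : ∀ᵐ ω ∂μ, centredProd μ (output f X Z) (output f X Z') ω
      - centredSq μ X (output f X Z) (output f X Z') ω / 2 = 0) :
    sobolIndex μ X (output f X Z) = 1 := by
  by_contra hS
  have := Measure.isProbabilityMeasure_map (μ := μ) hX.aemeasurable
  have := Measure.isProbabilityMeasure_map (μ := μ) hZ.aemeasurable
  set m := μ[output f X Z] with hm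
  set s := sobolIndex μ X (output f X Z) with hs
  let k : ℝ × ℝ → ℝ := fun p => (p.1 - m) * (p.2 - m) - s * ((p.1 - m) ^ 2 + (p.2 - m) ^ 2) / 2
  have hk : Continuous k := by fun_prop
  have hdiag : ∀ a, a ≠ m → k (a, a) ≠ 0 := by
    intro a ha
    have : k (a, a) = (1 - s) * (a - m) ^ 2 := by simp only [k]; ring
    rw [this]
    exact mul_ne_zero (sub_ne_zero.2 (Ne.symm hS)) (pow_ne_zero _ (sub_ne_zero.2 ha))
  have hT : AEMeasurable (fun ω => (X ω, Z ω, Z' ω)) μ := by fun_prop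
  have h1 : ∀ᵐ t ∂((μ.map X).prod ((μ.map Z).prod (μ.map Z))),
      k (f (t.1, t.2.1), f (t.1, t.2.2)) = 0 := by
    rw [← map_inputs hX hZ hZ' hXZ hXZZ' hcopy, ae_map_iff hT
      (measurableSet_eq_fun (by fun_prop) measurable_const)]
    exact h0
  have h2 : ∀ᵐ x ∂(μ.map X), ∀ᵐ z ∂(μ.map Z), f (x, z) = m := by
    filter_upwards [Measure.ae_ae_of_ae_prod h1] with x hx
    exact ae_eq_const_of_ae_prod_eq_zero (h := fun z => f (x, z)) (by fun_prop) hk hdiag hx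
  have h3 : ∀ᵐ t ∂((μ.map X).prod (μ.map Z)), f t = m :=
    (Measure.ae_prod_iff_ae_ae (measurableSet_eq_fun hf measurable_const)).2 h2
  rw [← hXZ.map_prod_eq_prod_map_map hX.aemeasurable hZ.aemeasurable] at h3
  have h4 : output f X Z =ᵐ[μ] fun _ => m := ae_of_ae_map (hX.prodMk hZ).aemeasurable h3
  exact hvar (by rw [variance_congr h4]; simp [variance_eq_integral])

/-- Bilinearity of the covariance; this identifies σ_e² as the limit variance of the difference of
two estimators on shared draws. -/
theorem sigmaESq_eq_variance {Y Y' Yc Yc' : Ω → ℝ}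
    (hA : MemLp (centredProd μ Y Y') 2 μ) (hB : MemLp (centredSq μ X Y Y') 2 μ)
    (hAc : MemLp (centredProd μ Yc Yc') 2 μ) (hBc : MemLp (centredSq μ X Yc Yc') 2 μ) :
    sigmaESq μ X Y Y' Yc Yc' =
      Var[fun ω => (centredProd μ Y Y' ω - centredSq μ X Y Y' ω / 2) / Var[Y; μ]
        - (centredProd μ Yc Yc' ω - centredSq μ X Yc Yc' ω / 2) / Var[Yc; μ]; μ] := by
  have hB2 : MemLp (fun ω => centredSq μ X Y Y' ω / 2) 2 μ := by
    simpa only [div_eq_mul_inv] using hB.mul_const (2 : ℝ)⁻¹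
  have hBc2 : MemLp (fun ω => centredSq μ X Yc Yc' ω / 2) 2 μ := by
    simpa only [div_eq_mul_inv] using hBc.mul_const (2 : ℝ)⁻¹
  have hW : MemLp (fun ω => (centredProd μ Y Y' ω - centredSq μ X Y Y' ω / 2) / Var[Y; μ]) 2 μ := by
    simpa only [div_eq_mul_inv _ Var[Y; μ], Pi.sub_apply] using (hA.sub hB2).mul_const (Var[Y; μ])⁻¹
  have hWc : MemLp (fun ω => (centredProd μ Yc Yc' ω - centredSq μ X Yc Yc' ω / 2) / Var[Yc; μ])
      2 μ := by
    simpa only [div_eq_mul_inv _ Var[Yc; μ], Pi.sub_apply] using (hAc.sub hBc2).mul_const (Var[Yc; μ])⁻¹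
  rw [variance_fun_sub hW hWc, variance_fun_div_const, variance_fun_div_const, covariance_fun_div_left,
    covariance_fun_div_right, covariance_fun_sub_fun_sub hA hB2 hAc hBc2,
    covariance_fun_div_left, covariance_fun_div_right, covariance_fun_div_left,
    covariance_fun_div_right, sigmaESq, sigmaSq, sigmaSq]
  ring

end PopulationFacts

/-! ### Translation of empirical moments -/

section Algebra

theorem mean_sub_mul_sub {n : ℕ} (hn : n ≠ 0) (u v : ℕ → ℝ) (m : ℝ) :
    1 / (n : ℝ) * ∑ i ∈ Finset.range n, (u i - m) * (v i - m) =
      1 / (n : ℝ) * ∑ i ∈ Finset.range n, u i * v i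
        - 2 * m * (1 / (n : ℝ) * ∑ i ∈ Finset.range n, (u i + v i) / 2) + m ^ 2 := by
  have h : ∀ i, (u i - m) * (v i - m) = u i * v i - 2 * m * ((u i + v i) / 2) + m ^ 2 :=
    fun i => by ring
  have hn' : (n : ℝ) ≠ 0 := Nat.cast_ne_zero.2 hn
  simp_rw [h, Finset.sum_add_distrib, Finset.sum_sub_distrib, ← Finset.mul_sum]
  simp only [Finset.sum_const, Finset.card_range, nsmul_eq_mul]
  field_simp

theorem mean_sub_add_sub {n : ℕ} (hn : n ≠ 0) (u v : ℕ → ℝ) (m : ℝ) :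
    1 / (n : ℝ) * ∑ i ∈ Finset.range n, ((u i - m) + (v i - m)) / 2 =
      1 / (n : ℝ) * ∑ i ∈ Finset.range n, (u i + v i) / 2 - m := by
  have h : ∀ i, ((u i - m) + (v i - m)) / 2 = (u i + v i) / 2 - m := fun i => by ring
  have hn' : (n : ℝ) ≠ 0 := Nat.cast_ne_zero.2 hn
  simp_rw [h, Finset.sum_sub_distrib]
  simp only [Finset.sum_const, Finset.card_range, nsmul_eq_mul]
  field_simp

theorem mean_sub_sq {n : ℕ} (hn : n ≠ 0) (u v : ℕ → ℝ) (m : ℝ) :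
    1 / (n : ℝ) * ∑ i ∈ Finset.range n, ((u i - m) ^ 2 + (v i - m) ^ 2) / 2 =
      1 / (n : ℝ) * ∑ i ∈ Finset.range n, (u i ^ 2 + v i ^ 2) / 2
        - 2 * m * (1 / (n : ℝ) * ∑ i ∈ Finset.range n, (u i + v i) / 2) + m ^ 2 := by
  have h : ∀ i, ((u i - m) ^ 2 + (v i - m) ^ 2) / 2 =
      (u i ^ 2 + v i ^ 2) / 2 - 2 * m * ((u i + v i) / 2) + m ^ 2 := fun i => by ring
  have hn' : (n : ℝ) ≠ 0 := Nat.cast_ne_zero.2 hn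
  simp_rw [h, Finset.sum_add_distrib, Finset.sum_sub_distrib, ← Finset.mul_sum]
  simp only [Finset.sum_const, Finset.card_range, nsmul_eq_mul]
  field_simp

end Algebra

/-! ### Asymptotic linearity of the estimator -/

section Linearization

variable {p₁ p₂ : ℕ}

/-- `A - B/2` as a function of the inputs, for the mean `m` and the Sobol index `s`. -/
def score (f : (Fin p₁ → ℝ) × (Fin p₂ → ℝ) → ℝ) (m s : ℝ)
    (t : (Fin p₁ → ℝ) × (Fin p₂ → ℝ) × (Fin p₂ → ℝ)) : ℝ :=
  (f (t.1, t.2.1) - m) * (f (t.1, t.2.2) - m)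
    - s * ((f (t.1, t.2.1) - m) ^ 2 + (f (t.1, t.2.2) - m) ^ 2) / 2

/-- The average of the two centred outputs. -/
def halfSum (f : (Fin p₁ → ℝ) × (Fin p₂ → ℝ) → ℝ) (m : ℝ)
    (t : (Fin p₁ → ℝ) × (Fin p₂ → ℝ) × (Fin p₂ → ℝ)) : ℝ :=
  ((f (t.1, t.2.1) - m) + (f (t.1, t.2.2) - m)) / 2

/-- The average of the squares of the two centred outputs. -/
def halfSumSq (f : (Fin p₁ → ℝ) × (Fin p₂ → ℝ) → ℝ) (m : ℝ)
    (t : (Fin p₁ → ℝ) × (Fin p₂ → ℝ) × (Fin p₂ → ℝ)) : ℝ :=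
  ((f (t.1, t.2.1) - m) ^ 2 + (f (t.1, t.2.2) - m) ^ 2) / 2

variable {f : (Fin p₁ → ℝ) × (Fin p₂ → ℝ) → ℝ} {m s V : ℝ}

theorem measurable_score (hf : Measurable f) : Measurable (score f m s) := by
  unfold score; fun_prop

theorem measurable_halfSum (hf : Measurable f) : Measurable (halfSum f m) := by
  unfold halfSum; fun_prop

theorem measurable_halfSumSq (hf : Measurable f) : Measurable (halfSumSq f m) := by
  unfold halfSumSq; fun_prop

variable {Ω Ω' : Type*}

/-- The denominator of the pick-freeze estimator. -/
def denominator (f : (Fin p₁ → ℝ) × (Fin p₂ → ℝ) → ℝ) (m : ℝ)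
    (ξ : ℕ → Ω' → (Fin p₁ → ℝ) × (Fin p₂ → ℝ) × (Fin p₂ → ℝ)) (n : ℕ) (ω : Ω') : ℝ :=
  sampleMean ξ (halfSumSq f m) n ω - sampleMean ξ (halfSum f m) n ω ^ 2

/-- Numerator and denominator are unchanged when the outputs are translated by m, and (a - b²) - s
(d - b²) = (a - s d) - (1 - s) b². The `if` records that division by a zero denominator returns 0.
-/
theorem modelEstimator_sub_eq (Xs : ℕ → Ω' → Fin p₁ → ℝ) (Zs Zs' : ℕ → Ω' → Fin p₂ → ℝ) {n : ℕ}
    (hn : n ≠ 0) (m s : ℝ) (ω : Ω') :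
    let ξ := fun i ω => (Xs i ω, Zs i ω, Zs' i ω)
    modelEstimator f Xs Zs Zs' n ω - s =
      (sampleMean ξ (score f m s) n ω - (1 - s) * sampleMean ξ (halfSum f m) n ω ^ 2)
        * (denominator f m ξ n ω)⁻¹ - if denominator f m ξ n ω = 0 then s else 0 := by
  intro ξ
  set u : ℕ → ℝ := fun i => f (Xs i ω, Zs i ω) with hu
  set v : ℕ → ℝ := fun i => f (Xs i ω, Zs' i ω) with hv
  have hM : sampleMean ξ (halfSum f m) n ω =
      1 / (n : ℝ) * ∑ i ∈ Finset.range n, (u i + v i) / 2 - m := mean_sub_add_sub hn u v m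
  have hD : sampleMean ξ (halfSumSq f m) n ω =
      1 / (n : ℝ) * ∑ i ∈ Finset.range n, (u i ^ 2 + v i ^ 2) / 2
        - 2 * m * (1 / (n : ℝ) * ∑ i ∈ Finset.range n, (u i + v i) / 2) + m ^ 2 :=
    mean_sub_sq hn u v m
  have hW : sampleMean ξ (score f m s) n ω =
      1 / (n : ℝ) * ∑ i ∈ Finset.range n, (u i - m) * (v i - m)
        - s * sampleMean ξ (halfSumSq f m) n ω := by
    simp only [sampleMean, score, halfSumSq, Finset.sum_sub_distrib, mul_div_assoc,
      ← Finset.mul_sum, ξ, hu, hv]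
    ring
  rw [mean_sub_mul_sub hn] at hW
  have hest : modelEstimator f Xs Zs Zs' n ω =
      (1 / (n : ℝ) * ∑ i ∈ Finset.range n, u i * v i
        - (1 / (n : ℝ) * ∑ i ∈ Finset.range n, (u i + v i) / 2) ^ 2) /
      (1 / (n : ℝ) * ∑ i ∈ Finset.range n, (u i ^ 2 + v i ^ 2) / 2
        - (1 / (n : ℝ) * ∑ i ∈ Finset.range n, (u i + v i) / 2) ^ 2) := rfl
  set a := 1 / (n : ℝ) * ∑ i ∈ Finset.range n, u i * v i
  set b := 1 / (n : ℝ) * ∑ i ∈ Finset.range n, (u i + v i) / 2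
  set d := 1 / (n : ℝ) * ∑ i ∈ Finset.range n, (u i ^ 2 + v i ^ 2) / 2
  have hden : denominator f m ξ n ω = d - b ^ 2 := by
    rw [denominator, hD, hM]; ring
  rw [hest, hden, hW, hD, hM]
  split_ifs with h
  · simp [h]
  · field_simp
    ring

variable [MeasurableSpace Ω] [MeasurableSpace Ω'] {μ : Measure Ω} {P : Measure Ω'}
  {τ : Ω → (Fin p₁ → ℝ) × (Fin p₂ → ℝ) × (Fin p₂ → ℝ)}

theorem aemeasurable_modelEstimator {Xs : ℕ → Ω' → Fin p₁ → ℝ} {Zs Zs' : ℕ → Ω' → Fin p₂ → ℝ}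
    (hd : ∀ i, IdentDistrib (fun ω => (Xs i ω, Zs i ω, Zs' i ω)) τ P μ) (hf : Measurable f)
    (n : ℕ) : AEMeasurable (modelEstimator f Xs Zs Zs' n) P := by
  have h1 : ∀ i, AEMeasurable (fun ω => f (Xs i ω, Zs i ω)) P := fun i =>
    (show Measurable fun t : (Fin p₁ → ℝ) × (Fin p₂ → ℝ) × (Fin p₂ → ℝ) => f (t.1, t.2.1) by
      fun_prop).comp_aemeasurable (hd i).aemeasurable_fst
  have h2 : ∀ i, AEMeasurable (fun ω => f (Xs i ω, Zs' i ω)) P := fun i =>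
    (show Measurable fun t : (Fin p₁ → ℝ) × (Fin p₂ → ℝ) × (Fin p₂ → ℝ) => f (t.1, t.2.2) by
      fun_prop).comp_aemeasurable (hd i).aemeasurable_fst
  have h3 : AEMeasurable (fun ω => ∑ i ∈ Finset.range n, f (Xs i ω, Zs i ω) * f (Xs i ω, Zs' i ω)) P :=
    Finset.aemeasurable_fun_sum _ fun i _ => (h1 i).mul (h2 i)
  have h4 : AEMeasurable
      (fun ω => ∑ i ∈ Finset.range n, (f (Xs i ω, Zs i ω) + f (Xs i ω, Zs' i ω)) / 2) P :=
    Finset.aemeasurable_fun_sum _ fun i _ => ((h1 i).add (h2 i)).div_const 2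
  have h5 : AEMeasurable
      (fun ω => ∑ i ∈ Finset.range n, (f (Xs i ω, Zs i ω) ^ 2 + f (Xs i ω, Zs' i ω) ^ 2) / 2) P :=
    Finset.aemeasurable_fun_sum _ fun i _ =>
      (((h1 i).pow_const 2).add ((h2 i).pow_const 2)).div_const 2
  exact ((h3.const_mul _).sub ((h4.const_mul _).pow_const 2)).div
    ((h5.const_mul _).sub ((h4.const_mul _).pow_const 2))

theorem aemeasurable_denominator {ξ : ℕ → Ω' → (Fin p₁ → ℝ) × (Fin p₂ → ℝ) × (Fin p₂ → ℝ)}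
    (hd : ∀ i, IdentDistrib (ξ i) τ P μ) (hf : Measurable f) (n : ℕ) :
    AEMeasurable (denominator f m ξ n) P :=
  (aemeasurable_sampleMean hd (measurable_halfSumSq hf) n).sub
    ((aemeasurable_sampleMean hd (measurable_halfSum hf) n).pow_const 2)

/-- The moments of the centred outputs that drive the asymptotics of the pick-freeze estimator. -/
structure HasScoreMoments (μ : Measure Ω)
    (τ : Ω → (Fin p₁ → ℝ) × (Fin p₂ → ℝ) × (Fin p₂ → ℝ))
    (f : (Fin p₁ → ℝ) × (Fin p₂ → ℝ) → ℝ) (m s V : ℝ) : Prop where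
  memLp_halfSum : MemLp (fun ω => halfSum f m (τ ω)) 2 μ
  integral_halfSum : ∫ ω, halfSum f m (τ ω) ∂μ = 0
  integrable_halfSumSq : Integrable (fun ω => halfSumSq f m (τ ω)) μ
  integral_halfSumSq : ∫ ω, halfSumSq f m (τ ω) ∂μ = V
  memLp_score : MemLp (fun ω => score f m s (τ ω)) 2 μ
  integral_score : ∫ ω, score f m s (τ ω) ∂μ = 0

variable [IsProbabilityMeasure μ] {ξ : ℕ → Ω' → (Fin p₁ → ℝ) × (Fin p₂ → ℝ) × (Fin p₂ → ℝ)}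

theorem ae_tendsto_sampleMean_halfSum (hξ : iIndepFun ξ P) (hd : ∀ i, IdentDistrib (ξ i) τ P μ)
    (hf : Measurable f) (h : HasScoreMoments μ τ f m s V) :
    ∀ᵐ ω ∂P, Tendsto (fun n => sampleMean ξ (halfSum f m) n ω) atTop (𝓝 0) := by
  rw [← h.integral_halfSum]
  exact ae_tendsto_sampleMean hξ hd (measurable_halfSum hf) (h.memLp_halfSum.integrable one_le_two)

theorem ae_tendsto_denominator (hξ : iIndepFun ξ P) (hd : ∀ i, IdentDistrib (ξ i) τ P μ)
    (hf : Measurable f) (h : HasScoreMoments μ τ f m s V) :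
    ∀ᵐ ω ∂P, Tendsto (fun n => denominator f m ξ n ω) atTop (𝓝 V) := by
  filter_upwards [ae_tendsto_sampleMean_halfSum hξ hd hf h,
    ae_tendsto_sampleMean hξ hd (measurable_halfSumSq hf) h.integrable_halfSumSq] with ω h1 h2
  rw [h.integral_halfSumSq] at h2
  simpa [denominator] using h2.sub (h1.pow 2)

/-- Asymptotic linearity of the pick-freeze estimator. -/
theorem tendstoInMeasure_modelEstimator_sub_score [IsProbabilityMeasure P]
    {Xs : ℕ → Ω' → Fin p₁ → ℝ} {Zs Zs' : ℕ → Ω' → Fin p₂ → ℝ}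
    (hξ : iIndepFun (fun i ω => (Xs i ω, Zs i ω, Zs' i ω)) P)
    (hd : ∀ i, IdentDistrib (fun ω => (Xs i ω, Zs i ω, Zs' i ω)) τ P μ)
    (hf : Measurable f) (h : HasScoreMoments μ τ f m s V) (hV : V ≠ 0) :
    TendstoInMeasure P (fun (n : ℕ) ω => √n * (modelEstimator f Xs Zs Zs' n ω - s)
      - √n * sampleMean (fun i ω => (Xs i ω, Zs i ω, Zs' i ω)) (score f m s) n ω / V) atTop
      (fun _ => 0) := by
  set ξ := fun i ω => (Xs i ω, Zs i ω, Zs' i ω) with hξdef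
  have hM0 := ae_tendsto_sampleMean_halfSum hξ hd hf h
  have hDV := ae_tendsto_denominator hξ hd hf h
  have hMm := aemeasurable_sampleMean hd (measurable_halfSum (m := m) hf)
  have hDm := aemeasurable_denominator (m := m) hd hf
  -- Cost of replacing the random denominator by its limit V in the linear term.
  have h1 := tendstoInMeasure_mul_of_tendstoInDistribution
    (tendstoInDistribution_sqrt_mul_sampleMean hξ hd (measurable_score hf) h.memLp_score
      h.integral_score) (R := fun n ω => (denominator f m ξ n ω)⁻¹ - V⁻¹)
    (by
      filter_upwards [hDV] with ω hω
      simpa using (hω.inv₀ hV).sub_const V⁻¹)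
    (fun n => (hDm n).inv.sub_const _)
  -- The quadratic term is split as (√n M) · (M / D): the first factor converges in law, the second
  -- tends to 0 almost surely.
  have h2 := tendstoInMeasure_const_mul (-(1 - s)) <|
    tendstoInMeasure_mul_of_tendstoInDistribution
    (tendstoInDistribution_sqrt_mul_sampleMean hξ hd (measurable_halfSum hf) h.memLp_halfSum
      h.integral_halfSum)
    (R := fun n ω => sampleMean ξ (halfSum f m) n ω * (denominator f m ξ n ω)⁻¹)
    (by
      filter_upwards [hM0, hDV] with ω hω1 hω2
      simpa using hω1.mul (hω2.inv₀ hV))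
    (fun n => (hMm n).mul (hDm n).inv)
  -- The default-value term is eventually exactly zero almost surely, so the factor √n is harmless.
  have h3 : TendstoInMeasure P (fun (n : ℕ) ω => -(√n * if denominator f m ξ n ω = 0 then s else 0))
      atTop (fun _ => 0) := by
    refine tendstoInMeasure_of_tendsto_ae (fun n => ?_) ?_
    · have : Measurable fun x : ℝ => if x = 0 then s else 0 :=
        Measurable.ite (measurableSet_singleton 0) measurable_const measurable_const
      exact ((this.comp_aemeasurable (hDm n)).const_mul _).neg.aestronglyMeasurable
    · filter_upwards [hDV] with ω hω
      refine tendsto_const_nhds.congr' ?_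
      filter_upwards [hω.eventually_ne hV] with n hn
      simp [hn]
  refine (tendstoInMeasure_add (tendstoInMeasure_add h1 h2) h3).congr_left fun n => ?_
  refine ae_of_all _ fun ω => ?_
  rcases eq_or_ne n 0 with rfl | hn
  · simp
  · simp only
    rw [modelEstimator_sub_eq Xs Zs Zs' hn m s ω]
    ring

/-- For s = 1 the quadratic term has coefficient 0, and the linear one vanishes on the whole sample.
-/
theorem ae_eventually_modelEstimator_eq_one
    {Xs : ℕ → Ω' → Fin p₁ → ℝ} {Zs Zs' : ℕ → Ω' → Fin p₂ → ℝ}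
    (hξ : iIndepFun (fun i ω => (Xs i ω, Zs i ω, Zs' i ω)) P)
    (hd : ∀ i, IdentDistrib (fun ω => (Xs i ω, Zs i ω, Zs' i ω)) τ P μ)
    (hf : Measurable f) (h : HasScoreMoments μ τ f m 1 V) (hV : V ≠ 0)
    (h0 : ∀ᵐ ω ∂μ, score f m 1 (τ ω) = 0) :
    ∀ᵐ ω ∂P, ∀ᶠ n in atTop, modelEstimator f Xs Zs Zs' n ω = 1 := by
  have hz : ∀ᵐ ω ∂P, ∀ i, score f m 1 (Xs i ω, Zs i ω, Zs' i ω) = 0 := by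
    refine ae_all_iff.2 fun i => ?_
    exact (hd i).symm.ae_snd (p := fun t => score f m 1 t = 0)
      (measurableSet_eq_fun (measurable_score hf) measurable_const) h0
  filter_upwards [hz, ae_tendsto_denominator hξ hd hf h] with ω hω1 hω2
  filter_upwards [hω2.eventually_ne hV, eventually_ne_atTop 0] with n hn1 hn2
  have := modelEstimator_sub_eq (f := f) Xs Zs Zs' hn2 m 1 ω
  simp only [hn1, sampleMean, hω1] at this
  simpa [sub_eq_zero] using this

end Linearization

/-! ### Limit laws of the estimator and of the correction -/

section AsymptoticNormality

variable {p₁ p₂ : ℕ} {Ω Ω' : Type*} [MeasurableSpace Ω] [MeasurableSpace Ω'] {μ : Measure Ω}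
  {P : Measure Ω'} [IsProbabilityMeasure P]
  {τ : Ω → (Fin p₁ → ℝ) × (Fin p₂ → ℝ) × (Fin p₂ → ℝ)}
  {f fc : (Fin p₁ → ℝ) × (Fin p₂ → ℝ) → ℝ} {m s V mc sc Vc : ℝ}
  {Xs : ℕ → Ω' → Fin p₁ → ℝ} {Zs Zs' : ℕ → Ω' → Fin p₂ → ℝ}

theorem tendstoInDistribution_modelEstimator [IsProbabilityMeasure μ]
    (hξ : iIndepFun (fun i ω => (Xs i ω, Zs i ω, Zs' i ω)) P)
    (hd : ∀ i, IdentDistrib (fun ω => (Xs i ω, Zs i ω, Zs' i ω)) τ P μ)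
    (hf : Measurable f) (h : HasScoreMoments μ τ f m s V) (hV : V ≠ 0) :
    TendstoInDistribution (fun (n : ℕ) ω => √n * (modelEstimator f Xs Zs Zs' n ω - s)) atTop
      (fun x => √(Var[fun ω => score f m s (τ ω); μ] / V ^ 2) * x) (fun _ => P)
      (gaussianReal 0 1) := by
  have hL2 : MemLp (fun ω => score f m s (τ ω) / V) 2 μ := by
    simpa only [div_eq_mul_inv] using h.memLp_score.mul_const V⁻¹
  have hclt := tendstoInDistribution_sqrt_mul_sampleMean hξ hd
    (g := fun t => score f m s t / V) ((measurable_score hf).div_const V) hL2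
    (by rw [integral_div, h.integral_score, zero_div])
  rw [variance_fun_div_const] at hclt
  refine tendstoInDistribution_of_tendstoInMeasure_sub _ _ hclt ?_
    fun n => ((aemeasurable_modelEstimator hd hf n).sub_const s).const_mul _
  refine (tendstoInMeasure_modelEstimator_sub_score hξ hd hf h hV).congr_left fun n =>
    ae_of_all _ fun ω => ?_
  simp only [Pi.sub_apply, sampleMean, ← Finset.sum_div]
  ring

/-- Since the draws are shared, the two linear parts merge into one i.i.d. mean, and the scalar
central limit theorem is enough. -/
theorem tendstoInDistribution_modelEstimator_sub_modelEstimator [IsProbabilityMeasure μ]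
    (hξ : iIndepFun (fun i ω => (Xs i ω, Zs i ω, Zs' i ω)) P)
    (hd : ∀ i, IdentDistrib (fun ω => (Xs i ω, Zs i ω, Zs' i ω)) τ P μ)
    (hf : Measurable f) (hfc : Measurable fc)
    (h : HasScoreMoments μ τ f m s V) (hV : V ≠ 0)
    (hc : HasScoreMoments μ τ fc mc sc Vc) (hVc : Vc ≠ 0) :
    TendstoInDistribution (fun (n : ℕ) ω => √n * ((modelEstimator f Xs Zs Zs' n ω
        - modelEstimator fc Xs Zs Zs' n ω) - (s - sc))) atTop
      (fun x => √Var[fun ω => score f m s (τ ω) / V - score fc mc sc (τ ω) / Vc; μ] * x)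
      (fun _ => P) (gaussianReal 0 1) := by
  have hL2 : MemLp (fun ω => score f m s (τ ω) / V) 2 μ := by
    simpa only [div_eq_mul_inv] using h.memLp_score.mul_const V⁻¹
  have hL2c : MemLp (fun ω => score fc mc sc (τ ω) / Vc) 2 μ := by
    simpa only [div_eq_mul_inv] using hc.memLp_score.mul_const Vc⁻¹
  have hclt := tendstoInDistribution_sqrt_mul_sampleMean hξ hd
    (g := fun t => score f m s t / V - score fc mc sc t / Vc)
    (((measurable_score hf).div_const V).sub ((measurable_score hfc).div_const Vc))
    (hL2.sub hL2c) (by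
      rw [integral_sub (hL2.integrable one_le_two) (hL2c.integrable one_le_two), integral_div,
        integral_div, h.integral_score, hc.integral_score, zero_div, zero_div, sub_zero])
  refine tendstoInDistribution_of_tendstoInMeasure_sub _ _ hclt ?_
    fun n => (((aemeasurable_modelEstimator hd hf n).sub
      (aemeasurable_modelEstimator hd hfc n)).sub_const _).const_mul _
  refine (tendstoInMeasure_add (tendstoInMeasure_modelEstimator_sub_score hξ hd hf h hV)
    (tendstoInMeasure_const_mul (-1)
      (tendstoInMeasure_modelEstimator_sub_score hξ hd hfc hc hVc))).congr_left fun n =>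
    ae_of_all _ fun ω => ?_
  simp only [Pi.sub_apply, sampleMean, Finset.sum_sub_distrib, ← Finset.sum_div]
  ring

theorem tendsto_measureReal_modelEstimator_ne_one [IsProbabilityMeasure μ]
    (hξ : iIndepFun (fun i ω => (Xs i ω, Zs i ω, Zs' i ω)) P)
    (hd : ∀ i, IdentDistrib (fun ω => (Xs i ω, Zs i ω, Zs' i ω)) τ P μ)
    (hf : Measurable f) (h : HasScoreMoments μ τ f m 1 V) (hV : V ≠ 0)
    (h0 : ∀ᵐ ω ∂μ, score f m 1 (τ ω) = 0) :
    Tendsto (fun n => P.real {ω | modelEstimator f Xs Zs Zs' n ω ≠ 1}) atTop (𝓝 0) := by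
  have hmeas : Measurable fun x : ℝ => if x = 1 then (0 : ℝ) else 1 :=
    Measurable.ite (measurableSet_singleton 1) measurable_const measurable_const
  have hlim : TendstoInMeasure P
      (fun n ω => if modelEstimator f Xs Zs Zs' n ω = 1 then (0 : ℝ) else 1) atTop fun _ => 0 := by
    refine tendstoInMeasure_of_tendsto_ae (fun n => (hmeas.comp_aemeasurable
      (aemeasurable_modelEstimator hd hf n)).aestronglyMeasurable) ?_
    filter_upwards [ae_eventually_modelEstimator_eq_one hξ hd hf h hV h0] with ω hω
    refine tendsto_const_nhds.congr' ?_
    filter_upwards [hω] with n hn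
    simp [hn]
  rw [tendstoInMeasure_iff_measureReal_norm] at hlim
  refine (hlim 1 one_pos).congr fun n => ?_
  congr 1
  ext ω
  by_cases hω : modelEstimator f Xs Zs Zs' n ω = 1 <;> simp [hω]

end AsymptoticNormality

/-! ### Asymptotic levels of the two errors and their combination -/

section Coverage

variable {Ω Ω' : Type*} [MeasurableSpace Ω] [MeasurableSpace Ω'] {p₁ p₂ : ℕ} {μ : Measure Ω}
  [IsProbabilityMeasure μ] {X : Ω → Fin p₁ → ℝ} {Z Z' : Ω → Fin p₂ → ℝ}
  {f fc : (Fin p₁ → ℝ) × (Fin p₂ → ℝ) → ℝ}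

theorem hasScoreMoments (hX : Measurable X) (hZ : Measurable Z) (hZ' : Measurable Z')
    (hXZ : IndepFun X Z μ) (hXZZ' : IndepFun (fun ω => (X ω, Z ω)) Z' μ)
    (hcopy : IdentDistrib Z' Z μ μ) (hf : Measurable f) (hL2 : MemLp (output f X Z) 2 μ)
    (hvar : Var[output f X Z; μ] ≠ 0)
    (hA : MemLp (centredProd μ (output f X Z) (output f X Z')) 2 μ)
    (hB : MemLp (centredSq μ X (output f X Z) (output f X Z')) 2 μ) :
    HasScoreMoments μ (fun ω => (X ω, Z ω, Z' ω)) f (μ[output f X Z])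
      (sobolIndex μ X (output f X Z)) Var[output f X Z; μ] := by
  have hid := identDistrib_output hX hZ hZ' hXZ hXZZ' hcopy hf
  have hL2' : MemLp (output f X Z') 2 μ := hid.memLp_iff.2 hL2
  set m := μ[output f X Z] with hm
  have hu : MemLp (fun ω => output f X Z ω - m) 2 μ := hL2.sub (memLp_const m)
  have hv : MemLp (fun ω => output f X Z' ω - m) 2 μ := hL2'.sub (memLp_const m)
  have hu0 : ∫ ω, (output f X Z ω - m) ∂μ = 0 := by
    rw [integral_sub (hL2.integrable one_le_two) (integrable_const _)]
    simp [hm]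
  have hv0 : ∫ ω, (output f X Z' ω - m) ∂μ = 0 := by
    rw [← hu0]
    exact (hid.comp (measurable_id.sub_const m)).integral_eq
  have hu2 : ∫ ω, (output f X Z ω - m) ^ 2 ∂μ = Var[output f X Z; μ] :=
    (variance_eq_integral hL2.aemeasurable).symm
  have hv2 : ∫ ω, (output f X Z' ω - m) ^ 2 ∂μ = Var[output f X Z; μ] := by
    rw [← hu2]
    exact (hid.comp ((measurable_id.sub_const m).pow_const 2)).integral_eq
  have hsq : Integrable (fun ω => halfSumSq f m (X ω, Z ω, Z' ω)) μ :=
    (hu.integrable_sq.add hv.integrable_sq).div_const 2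
  have hsqint : ∫ ω, halfSumSq f m (X ω, Z ω, Z' ω) ∂μ = Var[output f X Z; μ] := by
    refine (integral_div 2 _).trans ?_
    rw [div_eq_iff two_ne_zero]
    refine (integral_add hu.integrable_sq hv.integrable_sq).trans ?_
    change (∫ ω, (output f X Z ω - m) ^ 2 ∂μ) + (∫ ω, (output f X Z' ω - m) ^ 2 ∂μ) = _
    rw [hu2, hv2]
    ring
  refine ⟨?_, ?_, hsq, hsqint, ?_, ?_⟩
  · have := (hu.add hv).mul_const (2 : ℝ)⁻¹
    exact this
  · refine (integral_div 2 _).trans ?_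
    rw [div_eq_zero_iff]
    refine Or.inl ((integral_add (hu.integrable one_le_two) (hv.integrable one_le_two)).trans ?_)
    change (∫ ω, (output f X Z ω - m) ∂μ) + (∫ ω, (output f X Z' ω - m) ∂μ) = 0
    rw [hu0, hv0, add_zero]
  · have := hA.sub (hB.mul_const (2 : ℝ)⁻¹)
    exact this
  -- The mean of A is Var E(Y|X) = S Var Y, which cancels the mean of B/2.
  · have hAi := hA.integrable one_le_two
    have heq : ∀ ω, score f m (sobolIndex μ X (output f X Z)) (X ω, Z ω, Z' ω) =
        centredProd μ (output f X Z) (output f X Z') ω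
          - sobolIndex μ X (output f X Z) * halfSumSq f m (X ω, Z ω, Z' ω) := by
      intro ω
      simp only [score, halfSumSq, centredProd, output, m]
      ring
    simp_rw [heq]
    rw [integral_sub hAi (hsq.const_mul _), integral_const_mul, hsqint,
      integral_centredProd hX hZ hZ' hXZ hXZZ' hcopy hf (hL2.integrable one_le_two) hAi,
      sobolIndex, div_mul_cancel₀ _ hvar, sub_self]

variable {P : Measure Ω'} [IsProbabilityMeasure P] {Xs : ℕ → Ω' → Fin p₁ → ℝ}
  {Zs Zs' : ℕ → Ω' → Fin p₂ → ℝ}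

/-- The confidence bound for one model; the variance of the estimator may vanish. -/
theorem eventually_measureReal_modelEstimator_lt (hX : Measurable X) (hZ : Measurable Z)
    (hZ' : Measurable Z') (hXZ : IndepFun X Z μ) (hXZZ' : IndepFun (fun ω => (X ω, Z ω)) Z' μ)
    (hcopy : IdentDistrib Z' Z μ μ) (hf : Measurable f) (hL2 : MemLp (output f X Z) 2 μ)
    (hvar : Var[output f X Z; μ] ≠ 0)
    (hA : MemLp (centredProd μ (output f X Z) (output f X Z')) 2 μ)
    (hB : MemLp (centredSq μ X (output f X Z) (output f X Z')) 2 μ)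
    (hs : IsInputSample μ X Z Z' P Xs Zs Zs') {a ε : ℝ} (ha : a ∈ Set.Ioo (0 : ℝ) 1) (hε : 0 < ε)
    {σ : ℕ → Ω' → ℝ}
    (hσ : TendstoInMeasure P σ atTop fun _ => sigmaC μ X (output f X Z) (output f X Z'))
    (hσ0 : sigmaC μ X (output f X Z) (output f X Z') = 0 → ∀ N, ∀ᵐ ω ∂P, 0 ≤ σ N ω) :
    ∀ᶠ n : ℕ in atTop, P.real {ω | q a * σ n ω <
      |√n * (modelEstimator f Xs Zs Zs' n ω - sobolIndex μ X (output f X Z))|} < a + ε := by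
  have hmom := hasScoreMoments hX hZ hZ' hXZ hXZZ' hcopy hf hL2 hvar hA hB
  have hnonneg : 0 ≤ sigmaC μ X (output f X Z) (output f X Z') := Real.sqrt_nonneg _
  rcases hnonneg.lt_or_eq with hpos | hzero
  · have hlim := tendstoInDistribution_modelEstimator hs.indep hs.identDistrib hf hmom hvar
    have hsigma : sigmaC μ X (output f X Z) (output f X Z') =
        √(Var[fun ω => score f (μ[output f X Z]) (sobolIndex μ X (output f X Z)) (X ω, Z ω, Z' ω);
          μ] / Var[output f X Z; μ] ^ 2) := by
      rw [sigmaC, sigmaSq]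
      rfl
    rw [← hsigma] at hlim
    exact eventually_measureReal_q_mul_lt_abs hpos hlim hσ ha hε
  -- Degenerate case: the score is almost surely 0 and the index is 1.
  have hzero' := hzero.symm
  have hvar0 : Var[fun ω => score f (μ[output f X Z]) (sobolIndex μ X (output f X Z))
      (X ω, Z ω, Z' ω); μ] = 0 := by
    rw [sigmaC, sigmaSq, Real.sqrt_eq_zero (div_nonneg (variance_nonneg _ _) (sq_nonneg _)),
      div_eq_zero_iff] at hzero'
    exact hzero'.resolve_right (pow_ne_zero 2 hvar)
  have hscore := ae_eq_integral_of_variance_eq_zero hmom.memLp_score hvar0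
  rw [hmom.integral_score] at hscore
  have hone : sobolIndex μ X (output f X Z) = 1 :=
    sobolIndex_eq_one_of_ae_eq hX hZ hZ' hXZ hXZZ' hcopy hf hvar hscore
  rw [hone] at hmom hscore ⊢
  have hlim := tendsto_measureReal_modelEstimator_ne_one hs.indep hs.identDistrib hf hmom hvar hscore
  filter_upwards [hlim.eventually (gt_mem_nhds (add_pos ha.1 hε))] with n hn
  -- Where the estimator equals 1 its error is 0, so a nonnegative bound cannot fail. The inclusion
  -- of events holds only almost everywhere because σ ≥ 0 does.
  refine lt_of_le_of_lt (ENNReal.toReal_mono (measure_ne_top _ _) (measure_mono_ae ?_)) hn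
  filter_upwards [hσ0 hzero.symm n] with ω hω hbad heq
  have hbad' : q a * σ n ω < |√n * (modelEstimator f Xs Zs Zs' n ω - 1)| := hbad
  rw [heq, sub_self, mul_zero, abs_zero] at hbad'
  exact absurd (mul_nonneg (q_pos ha).le hω) hbad'.not_ge

theorem eventually_measureReal_correction_lt (hX : Measurable X) (hZ : Measurable Z)
    (hZ' : Measurable Z') (hXZ : IndepFun X Z μ) (hXZZ' : IndepFun (fun ω => (X ω, Z ω)) Z' μ)
    (hcopy : IdentDistrib Z' Z μ μ) (hf : Measurable f) (hfc : Measurable fc)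
    (hL2 : MemLp (output f X Z) 2 μ) (hL2c : MemLp (output fc X Z) 2 μ)
    (hvar : Var[output f X Z; μ] ≠ 0) (hvarc : Var[output fc X Z; μ] ≠ 0)
    (hA : MemLp (centredProd μ (output f X Z) (output f X Z')) 2 μ)
    (hB : MemLp (centredSq μ X (output f X Z) (output f X Z')) 2 μ)
    (hAc : MemLp (centredProd μ (output fc X Z) (output fc X Z')) 2 μ)
    (hBc : MemLp (centredSq μ X (output fc X Z) (output fc X Z')) 2 μ)
    (hσe : 0 < sigmaE μ X (output f X Z) (output f X Z') (output fc X Z) (output fc X Z'))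
    (hs : IsInputSample μ X Z Z' P Xs Zs Zs') {ψ : ℕ → ℕ} (hψ : Tendsto ψ atTop atTop)
    {a ε : ℝ} (ha : a ∈ Set.Ioo (0 : ℝ) 1) (hε : 0 < ε) {σ : ℕ → Ω' → ℝ}
    (hσ : TendstoInMeasure P σ atTop
      fun _ => sigmaE μ X (output f X Z) (output f X Z') (output fc X Z) (output fc X Z')) :
    ∀ᶠ n : ℕ in atTop, P.real {ω | q a * σ n ω < |√(ψ n : ℝ) * (correction f fc ψ Xs Zs Zs' n ω
      - (sobolIndex μ X (output f X Z) - sobolIndex μ X (output fc X Z)))|} < a + ε := by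
  have hlim := tendstoInDistribution_modelEstimator_sub_modelEstimator hs.indep hs.identDistrib
    hf hfc (hasScoreMoments hX hZ hZ' hXZ hXZZ' hcopy hf hL2 hvar hA hB) hvar
    (hasScoreMoments hX hZ hZ' hXZ hXZZ' hcopy hfc hL2c hvarc hAc hBc) hvarc
  have hsigma : sigmaE μ X (output f X Z) (output f X Z') (output fc X Z) (output fc X Z') =
      √Var[fun ω => score f (μ[output f X Z]) (sobolIndex μ X (output f X Z)) (X ω, Z ω, Z' ω)
          / Var[output f X Z; μ]
        - score fc (μ[output fc X Z]) (sobolIndex μ X (output fc X Z)) (X ω, Z ω, Z' ω)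
          / Var[output fc X Z; μ]; μ] := by
    rw [sigmaE, sigmaESq_eq_variance hA hB hAc hBc]
    rfl
  rw [← hsigma] at hlim
  -- The limit law is read along n ↦ ψ n, while σ stays indexed by n.
  exact eventually_measureReal_q_mul_lt_abs hσe
    ⟨fun n => hlim.forall_aemeasurable (ψ n), hlim.aemeasurable_limit, hlim.tendsto.comp hψ⟩ hσ ha hε

/-- Only subadditivity is used, since events built from arbitrary estimators σ̂ need not be
measurable. -/
theorem one_sub_le_liminf_of_eventually_compl_lt {G B C : ℕ → Set Ω'} {b c : ℝ}
    (hsub : ∀ᶠ n in atTop, (G n)ᶜ ⊆ B n ∪ C n)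
    (hB : ∀ ε > 0, ∀ᶠ n in atTop, P.real (B n) < b + ε)
    (hC : ∀ ε > 0, ∀ᶠ n in atTop, P.real (C n) < c + ε) :
    1 - (b + c) ≤ liminf (fun n => P.real (G n)) atTop := by
  refine le_of_forall_pos_le_add fun ε hε => ?_
  rw [← sub_le_iff_le_add]
  refine le_liminf_of_le ?_ ?_
  · exact isCoboundedUnder_ge_of_le atTop (x := 1) fun n => measureReal_le_one
  · filter_upwards [hsub, hB (ε / 2) (half_pos hε), hC (ε / 2) (half_pos hε)] with n h1 h2 h3
    have h4 : P.real Set.univ ≤ P.real (G n) + P.real (G n)ᶜ := by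
      rw [← Set.union_compl_self (G n)]
      exact measureReal_union_le _ _
    have h5 := (measureReal_mono (μ := P) h1).trans (measureReal_union_le _ _)
    rw [probReal_univ] at h4
    linarith

theorem abs_sub_le_of_not_lt_sqrt_mul {n : ℕ} (hn : n ≠ 0) {c t s : ℝ}
    (h : ¬ c < |√(n : ℝ) * (t - s)|) : |t - s| ≤ c / √(n : ℝ) := by
  have hpos : 0 < √(n : ℝ) := Real.sqrt_pos.2 (by positivity)
  rw [le_div_iff₀' hpos]
  rwa [not_lt, abs_mul, abs_of_pos hpos] at h

end Coverage

end PickFreeze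

end

open PickFreeze in
theorem theorem1 {Ω Ω' : Type*} [MeasurableSpace Ω] [MeasurableSpace Ω'] {p₁ p₂ : ℕ}
    -- the inputs `X`, `Z` and the independent copy `Z'` of `Z`
    (μ : Measure Ω) [IsProbabilityMeasure μ]
    (X : Ω → Fin p₁ → ℝ) (Z Z' : Ω → Fin p₂ → ℝ)
    (hX : Measurable X) (hZ : Measurable Z) (hZ' : Measurable Z')
    (hXZ : IndepFun X Z μ) (hXZZ' : IndepFun (fun ω => (X ω, Z ω)) Z' μ)
    (hcopy : IdentDistrib Z' Z μ μ)
    -- the fine model `η`, the coarse model `ηc` and their outputs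
    (η ηc : (Fin p₁ → ℝ) × (Fin p₂ → ℝ) → ℝ) (hη : Measurable η) (hηc : Measurable ηc)
    (Y Y' Yc Yc' : Ω → ℝ)
    (hY : Y = output η X Z) (hY' : Y' = output η X Z')
    (hYc : Yc = output ηc X Z) (hYc' : Yc' = output ηc X Z')
    -- the outputs have finite nonzero variance, and `A`, `B`, `A_c`, `B_c` have finite variance
    (hYL2 : MemLp Y 2 μ) (hYcL2 : MemLp Yc 2 μ)
    (hYvar : Var[Y; μ] ≠ 0) (hYcvar : Var[Yc; μ] ≠ 0)
    (hA : MemLp (centredProd μ Y Y') 2 μ) (hB : MemLp (centredSq μ X Y Y') 2 μ)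
    (hAc : MemLp (centredProd μ Yc Yc') 2 μ) (hBc : MemLp (centredSq μ X Yc Yc') 2 μ)
    -- nondegeneracy of the correction term
    (hσe : 0 < sigmaE μ X Y Y' Yc Yc')
    -- the draws of the inputs for `T_N` and for the correction term; no assumption on their
    -- joint law (they may coincide, or be independent of each other)
    (P : Measure Ω') [IsProbabilityMeasure P]
    (Xs Xr : ℕ → Ω' → Fin p₁ → ℝ) (Zs Zs' Zr Zr' : ℕ → Ω' → Fin p₂ → ℝ)
    (hs : IsInputSample μ X Z Z' P Xs Zs Zs') (hr : IsInputSample μ X Z Z' P Xr Zr Zr')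
    (ψ : ℕ → ℕ) (hψ : Tendsto ψ atTop atTop)
    (αe αc : ℝ) (hαe : αe ∈ Set.Ioo (0 : ℝ) 1) (hαc : αc ∈ Set.Ioo (0 : ℝ) 1) :
    1 - (αe + αc) ≤ liminf (fun N : ℕ => P.real {ω |
        |sobolIndex μ X Y - varianceReduced η ηc ψ Xs Zs Zs' Xr Zr Zr' N ω| ≤
          q αe * sigmaE μ X Y Y' Yc Yc' / √(ψ N : ℝ) + q αc * sigmaC μ X Yc Yc' / √(N : ℝ)})
        atTop ∧
    ∀ σe σc : ℕ → Ω' → ℝ,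
      TendstoInMeasure P σe atTop (fun _ => sigmaE μ X Y Y' Yc Yc') →
      TendstoInMeasure P σc atTop (fun _ => sigmaC μ X Yc Yc') →
      (sigmaC μ X Yc Yc' = 0 → ∀ N, ∀ᵐ ω ∂P, 0 ≤ σc N ω) →
      1 - (αe + αc) ≤ liminf (fun N : ℕ => P.real {ω |
          |sobolIndex μ X Y - varianceReduced η ηc ψ Xs Zs Zs' Xr Zr Zr' N ω| ≤
            q αe * σe N ω / √(ψ N : ℝ) + q αc * σc N ω / √(N : ℝ)})
          atTop := by
  subst hY hY' hYc hYc'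
  -- The statement with estimated deviations contains the one with σ_e and σ_c, as constant
  -- sequences.
  have main : ∀ σe σc : ℕ → Ω' → ℝ,
      TendstoInMeasure P σe atTop (fun _ => sigmaE μ X (output η X Z) (output η X Z')
        (output ηc X Z) (output ηc X Z')) →
      TendstoInMeasure P σc atTop (fun _ => sigmaC μ X (output ηc X Z) (output ηc X Z')) →
      (sigmaC μ X (output ηc X Z) (output ηc X Z') = 0 → ∀ N, ∀ᵐ ω ∂P, 0 ≤ σc N ω) →
      1 - (αe + αc) ≤ liminf (fun N : ℕ => P.real {ω |
          |sobolIndex μ X (output η X Z) - varianceReduced η ηc ψ Xs Zs Zs' Xr Zr Zr' N ω| ≤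
            q αe * σe N ω / √(ψ N : ℝ) + q αc * σc N ω / √(N : ℝ)})
          atTop := by
    intro σe σc he hc h0
    refine one_sub_le_liminf_of_eventually_compl_lt ?_
      (fun ε hε => eventually_measureReal_correction_lt hX hZ hZ' hXZ hXZZ' hcopy hη hηc hYL2
        hYcL2 hYvar hYcvar hA hB hAc hBc hσe hr hψ hαe hε he)
      (fun ε hε => eventually_measureReal_modelEstimator_lt hX hZ hZ' hXZ hXZZ' hcopy hηc
        hYcL2 hYcvar hAc hBc hs hαc hε hc h0)
    -- Nonzero sample sizes allow division by √N and √ψ(N); if neither error exceeds its share, the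
    -- triangle inequality gives the bound.
    filter_upwards [eventually_ne_atTop 0, hψ.eventually_ne_atTop 0] with N hN hψN
    intro ω hω
    by_contra hcon
    rw [Set.mem_union, not_or] at hcon
    have h1 := abs_sub_le_of_not_lt_sqrt_mul hψN hcon.1
    have h2 := abs_sub_le_of_not_lt_sqrt_mul hN hcon.2
    refine hω ?_
    rw [Set.mem_ofPred_eq, abs_sub_comm]
    refine le_trans ?_ (add_le_add h1 h2)
    refine le_trans (le_of_eq ?_) (abs_add_le _ _)
    congr 1
    simp only [varianceReduced]
    ring
  have hconst : ∀ c : ℝ, TendstoInMeasure P (fun (_ : ℕ) (_ : Ω') => c) atTop fun _ => c :=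
    fun c => tendstoInMeasure_of_tendsto_ae (fun _ => aestronglyMeasurable_const)
      (ae_of_all _ fun _ => tendsto_const_nhds)
  exact ⟨main _ _ (hconst _) (hconst _) fun h _ => ae_of_all _ fun _ => h.ge, main⟩
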